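/- Definitions. A *tree order* is a partial order $T$ with a minimum element (its root) in which every set $\{y : y\le x\}$ is linearly ordered; it is a *well-stratified tree* if every such set is well-ordered. The *rank* of a node $x$ is the order type of $\{y : y<x\}$, the $\alpha$th *level* is the set of nodes of rank $\alpha$, and the *height* is the least $\alpha$ whose level is empty. A *branch* is a maximal linearly ordered subset. An *antichain* in a tree order is a set of pairwise incomparable elements; $T$ is *$\kappa$-cc* if it has no antichain of size $\kappa$, and *ccc* if it has no uncountable antichain. A *Suslin tree* is a ccc well-stratified tree of height $\omega_1$ all of whose levels and branches are countable. $T$ is *$Q$-gradable* if there is a strictly monotonic map $T\to Q$, and *$Q$-ungradable* otherwise. For an uncountable cardinal $\kappa$, a *${<}\kappa$-wide $\mathbb R$-ungradable tree* is an $\mathbb R$-ungradable, $\kappa$-cc well-stratified tree with no uncountable branches. $\mathrm{MA}_\kappa$ is the statement that for every partial order $\mathbb P$ with a maximum element in which every set of pairwise incompatible elements (no two distinct elements having a common lower bound) is countable, and every collection $\mathcal D$ of at most $\kappa$ dense subsets of $\mathbb P$, there is a filter on $\mathbb P$ which meets every member of $\mathcal D$. $\mathrm{MA}$ is the statement that $\mathrm{MA}_\kappa$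 holds for all $\kappa<\mathfrak c$, and $\mathrm{CH}$ is the statement $\mathfrak c=\aleph_1$. $\mathrm{In}_\omega$ is the tree of all injective functions $f\colon\alpha\to\omega$ with $\alpha$ an ordinal, ordered by inclusion. For a well-stratified tree $T$, $\mathrm{Pad}(T)$ is the result of adding a new node directly below every node of $T$ lying on the $0$th level or on a limit level. Proposition. (1) A partial order is a Suslin tree if and only if it is a ${<}\aleph_1$-wide $\mathbb R$-ungradable tree. (2) For every cardinal $\kappa\ge\aleph_1$, if $\mathrm{MA}_\kappa$ holds, then there are no ${<}\kappa^+$-wide $\mathbb R$-ungradable trees. (3) If $\mathrm{MA}$ and $\neg\mathrm{CH}$ hold, then there are no ${<}\mathfrak c$-wide $\mathbb R$-ungradable trees. (4) $\mathrm{Pad}(\mathrm{In}_\omega)$ is a ${<}\mathfrak c^+$-wide $\mathbb R$-ungradable tree; in particular, such a tree exists. -/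

import Mathlib

open scoped Cardinal Ordinal

universe u v

/-! ### Tree orders and well-stratified trees -/

/-- A tree order: a partial order with a minimum element (the root), in which the elements below
any given element are linearly ordered. -/
class IsTreeOrder (T : Type u) [PartialOrder T] : Prop where
  isChain_Iic : ∀ x : T, IsChain (· ≤ ·) (Set.Iic x)
  exists_root : ∃ r : T, ∀ x : T, r ≤ x

/-- A well-stratified tree: a tree order in which the elements below any given element are
well-ordered. -/
class IsWellStratifiedTree (T : Type u) [PartialOrder T] : Prop extends IsTreeOrder T where
  isWF_Iic : ∀ x : T, (Set.Iic x).IsWF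

/-- In a well-stratified tree, the strict predecessors of a node are well-ordered by `<`. -/
instance IsWellStratifiedTree.isWellOrder_Iio {T : Type u} [PartialOrder T]
    [IsWellStratifiedTree T] (x : T) : IsWellOrder (Set.Iio x) (· < ·) where
  wf := (IsWellStratifiedTree.isWF_Iic x).mono Set.Iio_subset_Iic_self
  trichotomous a b hab hba := by
    rcases (IsTreeOrder.isChain_Iic x).total (le_of_lt a.2) (le_of_lt b.2) with h | h
    · by_contra hne
      exact hab (lt_of_le_of_ne h hne)
    · by_contra hne
      exact hba (lt_of_le_of_ne h fun e => hne e.symm)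

/-- A branch: a maximal linearly ordered subset. -/
def IsBranch {T : Type u} [PartialOrder T] (B : Set T) : Prop :=
  IsMaxChain (· ≤ ·) B

/-- The rank of a node: the order type of its set of strict predecessors. -/
noncomputable def nodeRank {T : Type u} [PartialOrder T] [IsWellStratifiedTree T] (x : T) :
    Ordinal.{u} :=
  Ordinal.type (fun a b : Set.Iio x => a < b)

/-- The `α`-th level of a well-stratified tree. -/
def treeLevel (T : Type u) [PartialOrder T] [IsWellStratifiedTree T] (α : Ordinal.{u}) : Set T :=
  {x | nodeRank x = α}

/-- The height of a well-stratified tree: the least ordinal `α` such that the `α`-th level is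
empty. -/
noncomputable def treeHeight (T : Type u) [PartialOrder T] [IsWellStratifiedTree T] :
    Ordinal.{u} :=
  sInf {α | treeLevel T α = ∅}

/-- The infimum in the definition of the height is attained. -/
theorem isLeast_treeHeight (T : Type u) [PartialOrder T] [IsWellStratifiedTree T] :
    IsLeast {α | treeLevel T α = ∅} (treeHeight T) := by
  have hne : {α | treeLevel T α = ∅}.Nonempty := by
    obtain ⟨b, hb⟩ := Ordinal.bddAbove_of_small (s := Set.range fun x : T => nodeRank x)
    refine ⟨Order.succ b, Set.eq_empty_of_forall_notMem fun x hx => ?_⟩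
    have h1 : nodeRank x ≤ b := hb ⟨x, rfl⟩
    rw [show nodeRank x = Order.succ b from hx] at h1
    exact absurd h1 (not_le_of_gt (Order.lt_succ b))
  exact ⟨csInf_mem hne, fun _ h => csInf_le' h⟩

/-! ### Chain conditions, Suslin trees, gradings -/

/-- A tree order is ccc if it has no uncountable antichain. Here an antichain is a set of pairwise
incomparable elements. -/
def TreeCCC (T : Type u) [PartialOrder T] : Prop :=
  ∀ A : Set T, IsAntichain (· ≤ ·) A → A.Countable

/-- A tree order is `κ`-cc if it has no antichain of size `κ`. -/
def TreeCC (κ : Cardinal.{u}) (T : Type u) [PartialOrder T] : Prop :=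
  ¬ ∃ A : Set T, IsAntichain (· ≤ ·) A ∧ #A = κ

/-- An Aronszajn tree: a well-stratified tree of height `ω₁`, all of whose levels and branches
are countable. -/
structure IsAronszajnTree (T : Type u) [PartialOrder T] : Prop extends
    IsWellStratifiedTree T where
  height_eq : treeHeight T = ω₁
  countable_level : ∀ α : Ordinal.{u}, (treeLevel T α).Countable
  countable_branch : ∀ B : Set T, IsBranch B → B.Countable

/-- A Suslin tree: a ccc Aronszajn tree. -/
structure IsSuslinTree (T : Type u) [PartialOrder T] : Prop extends IsAronszajnTree T where
  ccc : TreeCCC T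

/-- `P` is `Q`-gradable if there is a strictly monotonic map from `P` to `Q`. -/
def Gradable (Q : Type v) [PartialOrder Q] (P : Type u) [PartialOrder P] : Prop :=
  ∃ f : P → Q, StrictMono f

/-- A `<κ`-wide `ℝ`-ungradable tree: an `ℝ`-ungradable, `κ`-cc well-stratified tree with no
uncountable branches. -/
structure IsWideUngradableTree (κ : Cardinal.{u}) (T : Type u) [PartialOrder T] : Prop extends
    IsWellStratifiedTree T where
  ungradable : ¬ Gradable ℝ T
  cc : TreeCC κ T
  countable_branch : ∀ B : Set T, IsBranch B → B.Countable

/-! ### Forcing posets and Martin's Axiom -/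

/-- An antichain in a forcing poset: a set of pairwise incompatible elements. -/
def IsForcingAntichain {P : Type u} [PartialOrder P] (A : Set P) : Prop :=
  ∀ x ∈ A, ∀ y ∈ A, x ≠ y → ¬ ∃ z : P, z ≤ x ∧ z ≤ y

/-- A forcing poset is ccc if it has no uncountable antichain of pairwise incompatible elements. -/
def ForcingCCC (P : Type u) [PartialOrder P] : Prop :=
  ∀ A : Set P, IsForcingAntichain A → A.Countable

/-- `MA_κ`: for every ccc partial order `P` with a maximum and every collection of at most `κ` dense
subsets of `P`, some filter on `P` meets all of them. (A set is dense if every element of `P` has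
an element of the set below it, which is `IsCoinitial`.) -/
def MartinAxiomAt (κ : Cardinal.{u}) : Prop :=
  ∀ (P : Type u) [PartialOrder P] [OrderTop P], ForcingCCC P →
    ∀ 𝒟 : Set (Set P), #𝒟 ≤ κ → (∀ D ∈ 𝒟, IsCoinitial D) →
      ∃ G : Order.PFilter P, ∀ D ∈ 𝒟, ∃ p ∈ G, p ∈ D

/-- Martin's Axiom: `MA_κ` holds for all `κ < 𝔠`. -/
def MartinAxiom : Prop :=
  ∀ κ : Cardinal.{u}, κ < 𝔠 → MartinAxiomAt κ

/-- The Continuum Hypothesis: `𝔠 = ℵ₁`. -/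
def ContinuumHypothesis : Prop :=
  (𝔠 : Cardinal.{u}) = ℵ₁

/-! ### The tree `Pad(T)` -/

/-- `Pad T` is the result of adding to the well-stratified tree `T` a new node directly below every
node lying on the `0`-th level or on a limit level, that is, on a level which is not a successor. -/
inductive Pad (T : Type u) [PartialOrder T] [IsWellStratifiedTree T] : Type u
  /-- a node of the original tree -/
  | node (x : T) : Pad T
  /-- the new node directly below `x` -/
  | below (x : T) (hx : ¬ ∃ α : Ordinal.{u}, nodeRank x = Order.succ α) : Pad T

namespace Pad

variable {T : Type u} [PartialOrder T] [IsWellStratifiedTree T]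

/-- The order of `Pad T`. -/
protected def le : Pad T → Pad T → Prop
  | node x, node y => x ≤ y
  | node x, below y _ => x < y
  | below x _, node y => x ≤ y
  | below x _, below y _ => x ≤ y

instance : PartialOrder (Pad T) where
  le := Pad.le
  le_refl a := by cases a <;> exact le_refl _
  le_trans a b c hab hbc := by
    cases a <;> cases b <;> cases c <;> simp only [Pad.le] at * <;> order
  le_antisymm a b hab hba := by
    cases a <;> cases b <;> simp only [Pad.le, node.injEq, below.injEq] at * <;> order

end Pad

/-! ### The tree `In_ω` -/

/-- The injective functions from an ordinal `dom` to `ω`; the ordinal `dom` is viewed as the set of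
all smaller ordinals. -/
@[ext]
structure InOmega : Type 1 where
  dom : Ordinal.{0}
  toFun : Set.Iio dom → ℕ
  inj : Function.Injective toFun

namespace InOmega

/-- Functions are ordered by extension, i.e. by inclusion of their graphs. -/
protected def le (f g : InOmega) : Prop :=
  ∃ h : f.dom ≤ g.dom, ∀ x : Set.Iio f.dom, f.toFun x = g.toFun ⟨x, lt_of_lt_of_le x.2 h⟩

instance : PartialOrder InOmega where
  le := InOmega.le
  le_refl f := ⟨le_rfl, fun _ => rfl⟩
  le_trans f g h := by
    rintro ⟨h1, h2⟩ ⟨h3, h4⟩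
    exact ⟨h1.trans h3, fun x => (h2 x).trans (h4 ⟨x, lt_of_lt_of_le x.2 h1⟩)⟩
  le_antisymm f g := by
    rintro ⟨h1, h2⟩ ⟨h3, h4⟩
    obtain ⟨a, f, hf⟩ := f
    obtain ⟨b, g, hg⟩ := g
    obtain rfl : a = b := le_antisymm h1 h3
    obtain rfl : f = g := funext h2
    rfl

theorem eq_of_le_of_dom {f g : InOmega} (h : f ≤ g) (hd : g.dom ≤ f.dom) : f = g := by
  refine le_antisymm h (show InOmega.le g f from ⟨hd, fun x => ?_⟩)
  obtain ⟨_, h2⟩ := h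
  exact (h2 ⟨x, lt_of_lt_of_le x.2 hd⟩).symm

theorem dom_lt_of_lt {f g : InOmega} (h : f < g) : f.dom < g.dom := by
  have h1 : InOmega.le f g := h.le
  exact lt_of_le_of_ne h1.1 fun e => h.ne (eq_of_le_of_dom h.le e.ge)

instance : IsWellStratifiedTree InOmega where
  isChain_Iic h f hf g hg _ := by
    obtain ⟨hf1, hf2⟩ := hf
    obtain ⟨hg1, hg2⟩ := hg
    rcases le_total f.dom g.dom with hd | hd
    · exact Or.inl ⟨hd, fun x => (hf2 x).trans (hg2 ⟨x, lt_of_lt_of_le x.2 hd⟩).symm⟩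
    · exact Or.inr ⟨hd, fun x => (hg2 x).trans (hf2 ⟨x, lt_of_lt_of_le x.2 hd⟩).symm⟩
  exists_root := by
    have hE : ∀ x : Set.Iio (0 : Ordinal.{0}), False := fun x => not_lt_bot (show x.1 < ⊥ from x.2)
    exact ⟨⟨0, fun _ => 0, fun x => (hE x).elim⟩, fun f => ⟨bot_le, fun x => (hE x).elim⟩⟩
  isWF_Iic h := by
    have hwf : WellFounded (fun f g : InOmega => f < g) :=
      Subrelation.wf (fun {_ _} h => dom_lt_of_lt h) (InvImage.wf InOmega.dom
        (wellFounded_lt (α := Ordinal.{0})))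
    have : WellFoundedLT InOmega := ⟨hwf⟩
    exact Set.IsWF.of_wellFoundedLT _

end InOmega

/-! ### Ranks of nodes -/

section Rank

variable {T : Type u} [PartialOrder T] [IsWellStratifiedTree T]

/-! A strictly monotone map to `ℝ` yields one to `ℚ` on nodes with an immediate predecessor: choose
rationals in the gaps (`exists_strictMono_rat`). Fibres over `ℚ` are antichains, so in a gradable
ccc tree the successor levels contain only countably many nodes, which height `ω₁` forbids.
Conversely, a countable tree is gradable, so an ungradable ccc tree with countable branches must
have height `ω₁`.

Under `MA_κ`, forcing with finite colourings gives every tree of size at most `κ` with countable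
branches a colouring by `ℕ` that separates comparable nodes, hence a grading in `ℝ`. The chain
condition is `exists_ne_not_colorConflict`. Since there are at most `ℵ₁` nonempty levels, bounds on
antichains bound the whole tree; for antichains smaller than `𝔠` this requires `ℵ₁ < cof 𝔠`, which
follows from `2 ^ ℵ₁ = 𝔠` (almost disjoint coding) and König's theorem.

A `ℚ`-grading of `In_ω` would, by recursion, inject all ordinals into `ℕ`. Padding supplies the
missing immediate predecessors, so an `ℝ`-grading of the padded tree would give such a `ℚ`-grading.
-/

theorem nodeRank_eq_typein {x y : T} (h : y < x) :
    nodeRank y = Ordinal.typein (fun a b : Set.Iio x => a < b) ⟨y, h⟩ := by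
  rw [← Ordinal.type_subrel]
  refine RelIso.ordinalType_congr ⟨⟨fun a => ⟨⟨a.1, lt_trans a.2 h⟩, a.2⟩, fun b => ⟨b.1.1, b.2⟩,
    fun _ => rfl, fun _ => rfl⟩, Iff.rfl⟩

theorem nodeRank_strictMono : StrictMono (nodeRank : T → Ordinal.{u}) := fun y x h => by
  rw [nodeRank_eq_typein h]
  exact Ordinal.typein_lt_type _ _

theorem exists_lt_nodeRank_eq {x : T} {α : Ordinal.{u}} (h : α < nodeRank x) :
    ∃ y < x, nodeRank y = α := by
  obtain ⟨⟨y, hy⟩, e⟩ := Ordinal.typein_surj (fun a b : Set.Iio x => a < b) h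
  exact ⟨y, hy, (nodeRank_eq_typein hy).trans e⟩

instance IsWellStratifiedTree.wellFoundedLT : WellFoundedLT T :=
  nodeRank_strictMono.wellFoundedLT

theorem IsTreeOrder.le_or_le {P : Type u} [PartialOrder P] [IsTreeOrder P] {x y z : P}
    (hx : x ≤ z) (hy : y ≤ z) : x ≤ y ∨ y ≤ x :=
  (IsTreeOrder.isChain_Iic z).total hx hy

/-- A node on a successor level has an immediate predecessor. -/
theorem exists_pred_of_nodeRank_eq_succ {x : T} {α : Ordinal.{u}}
    (h : nodeRank x = Order.succ α) : ∃ p < x, ∀ y < x, y ≤ p := by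
  obtain ⟨p, hp, e⟩ := exists_lt_nodeRank_eq (h ▸ Order.lt_succ α : α < nodeRank x)
  refine ⟨p, hp, fun y hy => ?_⟩
  rcases IsTreeOrder.le_or_le hy.le hp.le with hle | hle
  · exact hle
  · rcases hle.eq_or_lt with rfl | hlt
    · exact le_rfl
    · have h1 := nodeRank_strictMono hlt
      have h2 := nodeRank_strictMono hy
      rw [e] at h1
      rw [h, Order.lt_succ_iff] at h2
      exact absurd h1 h2.not_gt

theorem isAntichain_treeLevel (α : Ordinal.{u}) : IsAntichain (· ≤ ·) (treeLevel T α) := by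
  intro x hx y hy hne hle
  have h := nodeRank_strictMono (lt_of_le_of_ne hle hne)
  rw [show nodeRank x = α from hx, show nodeRank y = α from hy] at h
  exact h.false

end Rank

theorem IsChain.countable_of_branches {T : Type u} [PartialOrder T]
    (hB : ∀ B : Set T, IsBranch B → B.Countable) {C : Set T} (hC : IsChain (· ≤ ·) C) :
    C.Countable :=
  let ⟨M, hM, hCM⟩ := hC.exists_maxChain
  (hB M hM).mono hCM

theorem IsTreeOrder.countable_Iic {T : Type u} [PartialOrder T] [IsTreeOrder T]
    (hB : ∀ B : Set T, IsBranch B → B.Countable) (x : T) : (Set.Iic x).Countable :=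
  (IsTreeOrder.isChain_Iic x).countable_of_branches hB

theorem nodeRank_lt_omega_one {T : Type u} [PartialOrder T] [IsWellStratifiedTree T]
    (hB : ∀ B : Set T, IsBranch B → B.Countable) (x : T) : nodeRank x < ω₁ := by
  have h : #(Set.Iio x) < ℵ₁ := Cardinal.lt_aleph_one_iff.2
    ((IsTreeOrder.countable_Iic hB x).mono Set.Iio_subset_Iic_self).le_aleph0
  rw [← Cardinal.ord_aleph, Cardinal.lt_ord]
  simpa [nodeRank] using h

/-- Subsets of antichains are antichains, so forbidding size exactly `κ` also forbids every larger
size. -/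
theorem TreeCC.mk_lt {κ : Cardinal.{u}} {T : Type u} [PartialOrder T] (h : TreeCC κ T) {A : Set T}
    (hA : IsAntichain (· ≤ ·) A) : #A < κ := by
  by_contra! hle
  obtain ⟨B, hBA, hB⟩ := Cardinal.le_mk_iff_exists_subset.1 hle
  exact h ⟨B, hA.subset hBA, hB⟩

/-- The map sending a node to its rank, with values in a type of cardinality `ℵ₁`. -/
noncomputable def rankToType {T : Type u} [PartialOrder T] [IsWellStratifiedTree T]
    (hB : ∀ B : Set T, IsBranch B → B.Countable) (x : T) : (ω₁ : Ordinal.{u}).ToType :=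
  Ordinal.ToType.mk ⟨nodeRank x, nodeRank_lt_omega_one hB x⟩

theorem mk_omega_one_toType : #(ω₁ : Ordinal.{u}).ToType = ℵ₁ := by
  simp

/-- Countable branches keep all ranks below `ω₁`. As levels are antichains, this turns antichain
bounds into bounds on `#T`. -/
theorem mk_eq_sum_levels {T : Type u} [PartialOrder T] [IsWellStratifiedTree T]
    (hB : ∀ B : Set T, IsBranch B → B.Countable) :
    #T = Cardinal.sum fun i : (ω₁ : Ordinal.{u}).ToType => #(treeLevel T i.toOrd.1) := by
  rw [← Cardinal.mk_sigma, ← Cardinal.mk_congr (Equiv.sigmaFiberEquiv (rankToType hB))]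
  refine Cardinal.mk_congr (Equiv.sigmaCongrRight fun i => Equiv.subtypeEquivRight fun x => ?_)
  rw [rankToType, ← OrderIso.eq_symm_apply, Subtype.ext_iff]
  rfl

/-! ### Gradings and colourings -/

/-- A colouring with countably many colours in which comparable elements get different colours
yields a strictly monotone map to `ℝ`. -/
theorem gradable_real_of_coloring {P : Type u} [PartialOrder P] (c : P → ℕ)
    (hc : ∀ x y, x < y → c x ≠ c y) : Gradable ℝ P := by
  classical
  -- Send `x` to the sum of the weights `2⁻ⁿ` over the colours `n` occurring at or below `x`.
  -- Passing from `x` to `y > x` loses no colour and gains `c y`.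
  let N : P → Set ℕ := fun x => c '' Set.Iic x
  have hs : ∀ x, Summable ((N x).indicator fun n => (1 / 2 : ℝ) ^ n) := fun x =>
    summable_geometric_two.indicator _
  refine ⟨fun x => ∑' n, (N x).indicator (fun n => (1 / 2 : ℝ) ^ n) n, fun x y hxy => ?_⟩
  have hsub : N x ⊆ N y := Set.image_mono (Set.Iic_subset_Iic.2 hxy.le)
  refine Summable.tsum_lt_tsum (i := c y)
    (fun n => Set.indicator_le_indicator_of_subset hsub (fun n => by positivity) n) ?_ (hs x) (hs y)
  rw [Set.indicator_of_mem (show c y ∈ N y from ⟨y, le_rfl, rfl⟩), Set.indicator_of_notMem]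
  · positivity
  · rintro ⟨z, hz, e⟩
    exact hc z y (lt_of_le_of_lt hz hxy) e

theorem gradable_real_of_countable {P : Type u} [PartialOrder P] [Countable P] : Gradable ℝ P := by
  obtain ⟨c, hc⟩ := exists_injective_nat P
  exact gradable_real_of_coloring c fun x y h e => h.ne (hc e)

/-- If every element of `S` has something like an immediate predecessor in `T`, then a strictly
monotone map from `T` to `ℝ` yields one from `S` to `ℚ`. -/
theorem exists_strictMono_rat {S : Type u} {T : Type v} [PartialOrder S] [PartialOrder T]
    {f : T → ℝ} (hf : StrictMono f) (i p : S → T) (hp : ∀ x, p x < i x)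
    (h : ∀ x y, x < y → i x ≤ p y) : ∃ q : S → ℚ, StrictMono q := by
  -- For `x < y` the interval chosen for `x` ends no later than the one for `y` begins, since `i x ≤
  -- p y`.
  choose q hq1 hq2 using fun x => exists_rat_btwn (hf (hp x))
  refine ⟨q, fun x y hxy => ?_⟩
  have := hf.monotone (h x y hxy)
  exact_mod_cast (hq2 x).trans_le (this.trans (hq1 y).le)

/-! ### Suslin trees -/

theorem nodeRank_lt_treeHeight {T : Type u} [PartialOrder T] [IsWellStratifiedTree T] (x : T) :
    nodeRank x < treeHeight T := by
  have h : treeLevel T (treeHeight T) = ∅ := (isLeast_treeHeight T).1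
  by_contra! hle
  rcases hle.lt_or_eq with hlt | heq
  · obtain ⟨y, -, hy⟩ := exists_lt_nodeRank_eq hlt
    exact (h ▸ (hy : y ∈ treeLevel T _) : y ∈ (∅ : Set T))
  · exact (h ▸ (heq.symm : x ∈ treeLevel T _) : x ∈ (∅ : Set T))

theorem exists_nodeRank_eq {T : Type u} [PartialOrder T] [IsWellStratifiedTree T] {α : Ordinal.{u}}
    (h : α < treeHeight T) : ∃ x : T, nodeRank x = α := by
  by_contra! hne
  exact h.not_ge ((isLeast_treeHeight T).2 (Set.eq_empty_of_forall_notMem hne))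

theorem countable_Iio_of_lt_omega_one {α : Ordinal.{u}} (h : α < ω₁) :
    (Set.Iio α).Countable := by
  rw [← Cardinal.ord_aleph, Cardinal.lt_ord, Cardinal.lt_aleph_one_iff] at h
  rw [← Cardinal.le_aleph0_iff_set_countable, Cardinal.mk_Iio_ordinal, Cardinal.lift_le_aleph0]
  exact h

theorem IsSuslinTree.not_gradable_real {T : Type u} [PartialOrder T] (hT : IsSuslinTree T) :
    ¬ Gradable ℝ T := by
  have := hT.toIsWellStratifiedTree
  rintro ⟨f, hf⟩
  let S : Set T := {x | ∃ α, nodeRank x = Order.succ α}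
  have hp : ∀ x : S, ∃ p < x.1, ∀ y < x.1, y ≤ p := fun x =>
    let ⟨_, h⟩ := x.2
    exists_pred_of_nodeRank_eq_succ h
  choose p hp1 hp2 using hp
  obtain ⟨q, hq⟩ := exists_strictMono_rat hf (fun x : S => x.1) p hp1 fun x y h => hp2 y x h
  have hS : S.Countable := by
    have : S = ⋃ r : ℚ, Subtype.val '' (q ⁻¹' {r}) := by
      ext x
      simp only [Set.mem_iUnion, Set.mem_image, Set.mem_preimage, Set.mem_singleton_iff]
      exact ⟨fun hx => ⟨_, ⟨x, hx⟩, rfl, rfl⟩, fun ⟨_, y, _, e⟩ => e ▸ y.2⟩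
    rw [this]
    refine Set.countable_iUnion fun r => hT.ccc _ ?_
    rintro _ ⟨x, hx, rfl⟩ _ ⟨y, hy, rfl⟩ hne hle
    have : q x < q y := hq (lt_of_le_of_ne hle fun e => hne (congrArg _ e))
    rw [Set.mem_preimage, Set.mem_singleton_iff] at hx hy
    rw [hx, hy] at this
    exact this.false
  have hlim : Order.IsSuccLimit (ω₁ : Ordinal.{u}) := Cardinal.isSuccLimit_omega 1
  -- Since `ω₁` is a limit, each of the uncountably many successor levels below it contains a node
  -- of `S`.
  have hsurj : Set.Iio (ω₁ : Ordinal.{u}) ⊆ Order.succ ⁻¹' (nodeRank '' S) := by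
    intro α hα
    obtain ⟨x, hx⟩ := exists_nodeRank_eq (T := T) (hT.height_eq ▸ hlim.succ_lt hα)
    exact ⟨x, ⟨α, hx⟩, hx⟩
  have := ((hS.image _).preimage Order.succ_injective).mono hsurj
  rw [← Cardinal.le_aleph0_iff_set_countable, Cardinal.mk_Iio_ordinal, ← Cardinal.ord_aleph,
    Cardinal.card_ord] at this
  simp at this

theorem IsWideUngradableTree.treeCCC {T : Type u} [PartialOrder T]
    (hT : IsWideUngradableTree ℵ₁ T) : TreeCCC T := fun _ hA =>
  Cardinal.le_aleph0_iff_set_countable.1 (Cardinal.lt_aleph_one_iff.1 (hT.cc.mk_lt hA))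

theorem IsWideUngradableTree.treeHeight_eq {T : Type u} [PartialOrder T] [IsWellStratifiedTree T]
    (hT : IsWideUngradableTree ℵ₁ T) : treeHeight T = ω₁ := by
  refine le_antisymm ((isLeast_treeHeight T).2 (Set.eq_empty_of_forall_notMem fun x hx =>
    (nodeRank_lt_omega_one hT.countable_branch x).ne hx)) (le_of_not_gt fun hlt => hT.ungradable ?_)
  have hc : (Set.univ : Set T).Countable := by
    refine ((countable_Iio_of_lt_omega_one hlt).biUnion fun α _ =>
      hT.treeCCC _ (isAntichain_treeLevel (T := T) α)).mono fun x _ => ?_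
    simp only [Set.mem_iUnion]
    exact ⟨_, nodeRank_lt_treeHeight x, rfl⟩
  have := Set.countable_univ_iff.1 hc
  exact gradable_real_of_countable

theorem isSuslinTree_iff {T : Type u} [PartialOrder T] :
    IsSuslinTree T ↔ IsWideUngradableTree ℵ₁ T := by
  refine ⟨fun hT => ⟨hT.toIsWellStratifiedTree, hT.not_gradable_real, ?_, hT.countable_branch⟩,
    fun hT => ?_⟩
  · rintro ⟨A, hA, e⟩
    have := (hT.ccc A hA).le_aleph0
    rw [e] at this
    simp at this
  · have := hT.toIsWellStratifiedTree
    exact { hT.toIsWellStratifiedTree with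
      height_eq := hT.treeHeight_eq
      countable_level := fun α => hT.treeCCC _ (isAntichain_treeLevel α)
      countable_branch := hT.countable_branch
      ccc := hT.treeCCC }

/-! ### The specialization poset -/

theorem Set.Countable.preimage_of_countable_fibers {I : Type u} {E : Type v} {f : I → E}
    (hf : ∀ e, (f ⁻¹' {e}).Countable) {C : Set E} (hC : C.Countable) : (f ⁻¹' C).Countable := by
  rw [← Set.biUnion_preimage_singleton]
  exact hC.biUnion fun e _ => hf e

/-- An uncountable type carries an ultrafilter all of whose members are uncountable. -/
theorem exists_ultrafilter_uncountable (I : Type u) [Uncountable I] :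
    ∃ U : Ultrafilter I, ∀ S ∈ U, ¬ S.Countable := by
  have : (Filter.cocountable : Filter I).NeBot := by
    rw [Filter.neBot_iff, Ne, ← Filter.empty_mem_iff_bot, Filter.mem_cocountable]
    simpa using Set.not_countable_univ
  refine ⟨Ultrafilter.of Filter.cocountable, fun S hS hc => ?_⟩
  have h : Sᶜ ∈ Ultrafilter.of (Filter.cocountable : Filter I) :=
    Ultrafilter.of_le _ (by simpa [Filter.mem_cocountable] using hc)
  exact Ultrafilter.compl_mem_iff_notMem.1 h hS

/-- Two assignments of colours to nodes are in conflict if they assign different colours to the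
same node, or the same colour to comparable nodes. -/
def ColorConflict {T : Type u} [PartialOrder T] (e e' : T × ℕ) : Prop :=
  (e.1 = e'.1 ∧ e.2 ≠ e'.2) ∨ (e.1 < e'.1 ∨ e'.1 < e.1) ∧ e.2 = e'.2

theorem ColorConflict.symm {T : Type u} [PartialOrder T] {e e' : T × ℕ} (h : ColorConflict e e') :
    ColorConflict e' e := by
  unfold ColorConflict at *
  rcases h with ⟨h1, h2⟩ | ⟨h1, h2⟩
  · exact Or.inl ⟨h1.symm, h2.symm⟩
  · exact Or.inr ⟨h1.symm, h2.symm⟩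

/-- The combinatorial core of the theorem of Baumgartner, Malitz and Reinhardt. -/
theorem exists_ne_not_colorConflict {T : Type u} [PartialOrder T] [IsTreeOrder T]
    (hB : ∀ B : Set T, IsBranch B → B.Countable) (n : ℕ) :
    ∀ (I : Type v) [Uncountable I] (s : I → Fin n → T × ℕ),
      (∀ i a b, ¬ ColorConflict (s i a) (s i b)) →
      ∃ i j, i ≠ j ∧ ∀ a b, ¬ ColorConflict (s i a) (s j b) := by
  induction n with
  | zero =>
    intro I _ s _
    obtain ⟨i, j, h⟩ := exists_pair_ne I
    exact ⟨i, j, h, fun a => a.elim0⟩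
  | succ n ih =>
    intro I _ s hs
    -- If one coordinate is constant on an uncountable set, delete it and use induction: a conflict
    -- involving the common value would already occur within a single tuple.
    by_cases h : ∃ a e, ¬ ((fun i => s i a) ⁻¹' {e}).Countable
    · obtain ⟨a, e, h⟩ := h
      have : Uncountable ((fun i => s i a) ⁻¹' {e}) := by
        rw [← not_countable_iff]
        exact h
      obtain ⟨i, j, hij, hc⟩ := ih ((fun i => s i a) ⁻¹' {e}) (fun i k => s i.1 (a.succAbove k))
        fun i b c => hs _ _ _
      have hi : s i.1 a = e := i.2
      have hj : s j.1 a = e := j.2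
      refine ⟨i, j, fun e => hij (Subtype.ext e), fun b c => ?_⟩
      rcases Fin.eq_self_or_eq_succAbove a b with rfl | ⟨b, rfl⟩
      · rw [hi.trans hj.symm]
        exact hs _ _ _
      · rcases Fin.eq_self_or_eq_succAbove a c with rfl | ⟨c, rfl⟩
        · rw [hj.trans hi.symm]
          exact hs _ _ _
        · exact hc b c
    · push Not at h
      by_contra! hconf
      obtain ⟨U, hU⟩ := exists_ultrafilter_uncountable I
      -- There are only finitely many pairs of coordinates, so the ultrafilter selects one pair
      -- responsible for the conflict with almost every `j`.
      have hab : ∀ i, ∃ a b, ∀ᶠ j in U, ColorConflict (s i a) (s j b) := by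
        intro i
        simp_rw [← Ultrafilter.eventually_exists_iff]
        have hi : ({i}ᶜ : Set I) ∈ U := by
          rw [Ultrafilter.compl_mem_iff_notMem]
          exact fun h => hU _ h (Set.countable_singleton i)
        filter_upwards [hi] with j hj
        exact hconf i j (Ne.symm hj)
      choose a b hab using hab
      have hfib : ∀ (a : Fin (n + 1)) {C : Set T}, C.Countable →
          {i | (s i a).1 ∈ C}.Countable := fun a C hC => by
        refine (Set.Countable.preimage_of_countable_fibers (h a)
          (hC.prod Set.countable_univ)).mono ?_
        exact fun i hi => ⟨hi, Set.mem_univ _⟩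
      obtain ⟨⟨a₀, b₀, c₀⟩, hZ⟩ : ∃ k : Fin (n + 1) × Fin (n + 1) × ℕ,
          ¬ {i | (a i, b i, (s i (a i)).2) = k}.Countable := by
        by_contra! hk
        refine Set.not_countable_univ (α := I) ?_
        have := Set.Countable.preimage_of_countable_fibers hk Set.countable_univ
        exact this
      refine hZ ?_
      -- For `i`, `i'` in the class, uncountably many `j` conflict with both at `a₀`, `b₀`. Only
      -- countably many of these have their `b₀`-node below either `a₀`-node, so some `j` puts both
      -- `a₀`-nodes below one node, and they are comparable. The chain is countable and so are the
      -- fibres over it, so the class is countable.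
      have hchain : IsChain (· ≤ ·)
          ((fun i => (s i a₀).1) '' {i | (a i, b i, (s i (a i)).2) = (a₀, b₀, c₀)}) := by
        rintro _ ⟨i, hi, rfl⟩ _ ⟨i', hi', rfl⟩ -
        simp only [Set.mem_ofPred_eq, Prod.mk.injEq] at hi hi'
        have h1 := hab i
        have h2 := hab i'
        rw [hi.1, hi.2.1] at h1
        rw [hi'.1, hi'.2.1] at h2
        have hunc := hU _ (h1.and h2)
        have hcount := hfib b₀ ((IsTreeOrder.countable_Iic hB (s i a₀).1).union
          (IsTreeOrder.countable_Iic hB (s i' a₀).1))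
        obtain ⟨j, ⟨hj1, hj2⟩, hj⟩ : ∃ j ∈ {j | ColorConflict (s i a₀) (s j b₀) ∧
            ColorConflict (s i' a₀) (s j b₀)},
            j ∉ {j | (s j b₀).1 ∈ Set.Iic (s i a₀).1 ∪ Set.Iic (s i' a₀).1} := by
          by_contra! hsub
          exact hunc (hcount.mono hsub)
        simp only [Set.mem_ofPred_eq, Set.mem_union, Set.mem_Iic, not_or] at hj
        have key : ∀ {e e' : T × ℕ}, ColorConflict e e' → ¬ e'.1 ≤ e.1 → e.1 ≤ e'.1 := by
          rintro e e' (⟨h, -⟩ | ⟨h | h, -⟩) hn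
          · exact h.le
          · exact h.le
          · exact (hn h.le).elim
        exact IsTreeOrder.le_or_le (key hj1 hj.1) (key hj2 hj.2)
      refine (hfib a₀ (hchain.countable_of_branches hB)).mono ?_
      exact fun i hi => ⟨i, hi, rfl⟩

/-- The finite partial colourings of `T` with colours in `ℕ` which assign different colours to
comparable nodes. -/
@[ext]
structure PartialColoring (T : Type u) [PartialOrder T] : Type u where
  graph : Finset (T × ℕ)
  not_conflict : ∀ e ∈ graph, ∀ e' ∈ graph, ¬ ColorConflict e e'

namespace PartialColoring

variable {T : Type u} [PartialOrder T]

instance : PartialOrder (PartialColoring T) where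
  le p q := q.graph ⊆ p.graph
  le_refl p := Finset.Subset.refl _
  le_trans p q r h1 h2 := Finset.Subset.trans h2 h1
  le_antisymm p q h1 h2 := PartialColoring.ext (Finset.Subset.antisymm h2 h1)

instance : OrderTop (PartialColoring T) where
  top := ⟨∅, by simp⟩
  le_top p := Finset.empty_subset _

/-- Uncountably many conditions share one size `n`. Viewed as `n`-tuples, two of them have no
conflict, and their union is a common extension. -/
theorem forcingCCC [IsTreeOrder T] (hB : ∀ B : Set T, IsBranch B → B.Countable) :
    ForcingCCC (PartialColoring T) := by
  classical
  intro A hA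
  by_contra hunc
  obtain ⟨n, hn⟩ : ∃ n, ¬ {p | p ∈ A ∧ p.graph.card = n}.Countable := by
    by_contra! h
    refine hunc ((Set.countable_iUnion h).mono ?_)
    exact fun p hp => Set.mem_iUnion.2 ⟨_, hp, rfl⟩
  have : Uncountable {p | p ∈ A ∧ p.graph.card = n} := by
    rw [← not_countable_iff]
    exact hn
  obtain ⟨p, q, hpq, h⟩ := exists_ne_not_colorConflict hB n {p | p ∈ A ∧ p.graph.card = n}
    (fun p k => ((Finset.equivFinOfCardEq p.2.2).symm k).1)
    fun p a b => p.1.not_conflict _ (Subtype.prop _) _ (Subtype.prop _)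
  have hc : ∀ e ∈ p.1.graph, ∀ e' ∈ q.1.graph, ¬ ColorConflict e e' := fun e he e' he' => by
    simpa using h (Finset.equivFinOfCardEq p.2.2 ⟨e, he⟩) (Finset.equivFinOfCardEq q.2.2 ⟨e', he'⟩)
  refine hA p p.2.1 q q.2.1 (fun e => hpq (Subtype.ext e))
    ⟨⟨p.1.graph ∪ q.1.graph, fun e he e' he' => ?_⟩, Finset.subset_union_left,
      Finset.subset_union_right⟩
  rcases Finset.mem_union.1 he with he | he <;> rcases Finset.mem_union.1 he' with he' | he'
  · exact p.1.not_conflict _ he _ he'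
  · exact hc _ he _ he'
  · exact fun hcc => hc _ he' _ he hcc.symm
  · exact q.1.not_conflict _ he _ he'

theorem isCoinitial_color (t : T) :
    IsCoinitial {p : PartialColoring T | ∃ c, (t, c) ∈ p.graph} := by
  classical
  intro p
  by_cases h : ∃ c, (t, c) ∈ p.graph
  · exact ⟨p, h, le_rfl⟩
  obtain ⟨c, hc⟩ := Infinite.exists_notMem_finset (p.graph.image Prod.snd)
  have hc' : ∀ e ∈ p.graph, ¬ ColorConflict (t, c) e := by
    rintro ⟨t', c'⟩ he (⟨h1, -⟩ | ⟨-, h1⟩)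
    · exact h ⟨c', by simpa [show t = t' from h1] using he⟩
    · exact hc (Finset.mem_image.2 ⟨_, he, h1.symm⟩)
  refine ⟨⟨insert (t, c) p.graph, fun e he e' he' => ?_⟩, ⟨c, Finset.mem_insert_self _ _⟩,
    Finset.subset_insert _ _⟩
  rcases Finset.mem_insert.1 he with rfl | he <;> rcases Finset.mem_insert.1 he' with rfl | he'
  · simp [ColorConflict]
  · exact hc' _ he'
  · exact fun hcc => hc' _ he hcc.symm
  · exact p.not_conflict _ he _ he'

end PartialColoring

/-- Under `MA_κ`, every tree of size at most `κ` without uncountable branches is `ℝ`-gradable. -/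
theorem MartinAxiomAt.gradable_real {κ : Cardinal.{u}} (hMA : MartinAxiomAt κ) {T : Type u}
    [PartialOrder T] [IsTreeOrder T] (hB : ∀ B : Set T, IsBranch B → B.Countable)
    (hT : #T ≤ κ) : Gradable ℝ T := by
  obtain ⟨G, hG⟩ := hMA (PartialColoring T) (PartialColoring.forcingCCC hB)
    (Set.range fun t => {p | ∃ c, (t, c) ∈ p.graph}) (Cardinal.mk_range_le.trans hT)
    (by rintro _ ⟨t, rfl⟩; exact PartialColoring.isCoinitial_color t)
  choose p hpG c hc using fun t => hG _ ⟨t, rfl⟩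
  refine gradable_real_of_coloring c fun x y hxy e => ?_
  obtain ⟨r, -, h1, h2⟩ := G.directed _ (hpG x) _ (hpG y)
  exact r.not_conflict _ (h1 (hc x)) _ (h2 (hc y)) (Or.inr ⟨Or.inl hxy, e⟩)

theorem MartinAxiomAt.not_isWideUngradableTree {κ : Cardinal.{u}} (hκ : ℵ₁ ≤ κ)
    (hMA : MartinAxiomAt κ) (T : Type u) [PartialOrder T] :
    ¬ IsWideUngradableTree (Order.succ κ) T := by
  intro hT
  have := hT.toIsWellStratifiedTree
  refine hT.ungradable (hMA.gradable_real hT.countable_branch ?_)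
  rw [mk_eq_sum_levels hT.countable_branch]
  have hκ' : ℵ₀ ≤ κ := (Cardinal.aleph0_le_aleph 1).trans hκ
  refine (Cardinal.sum_le_sum _ (fun _ => κ) fun i =>
    Order.lt_succ_iff.1 (hT.cc.mk_lt (isAntichain_treeLevel _))).trans ?_
  rw [Cardinal.sum_const', mk_omega_one_toType]
  exact Cardinal.mul_le_of_le hκ' hκ le_rfl

/-! ### Almost disjoint coding -/

/-- The list of the first `n` values of a binary sequence. -/
def binaryPrefix (x : ℕ → Bool) (n : ℕ) : List Bool :=
  (List.range n).map x

theorem length_binaryPrefix (x : ℕ → Bool) (n : ℕ) : (binaryPrefix x n).length = n := by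
  simp [binaryPrefix]

theorem binaryPrefix_ne {x y : ℕ → Bool} {m n : ℕ} (h : x m ≠ y m) (hmn : m < n) :
    binaryPrefix x n ≠ binaryPrefix y n := fun e =>
  h (List.map_inj_left.1 e m (List.mem_range.2 hmn))

/-- Conditions for coding a set `X` of indices of binary sequences by a set of binary lists. A
condition consists of a finite part of the set of lists, and a finite set of indices outside `X`
whose sequences are promised to get no new prefixes. -/
@[ext]
structure CodingCondition {I : Type u} (x : I → ℕ → Bool) (X : Set I) : Type u where
  lists : Finset (List Bool)
  indices : Finset I
  notMem : ∀ i ∈ indices, i ∉ X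

namespace CodingCondition

variable {I : Type u} {x : I → ℕ → Bool} {X : Set I}

instance : PartialOrder (CodingCondition x X) where
  le p q := q.lists ⊆ p.lists ∧ q.indices ⊆ p.indices ∧
    ∀ i ∈ q.indices, ∀ l ∈ p.lists, l = binaryPrefix (x i) l.length → l ∈ q.lists
  le_refl p := ⟨Finset.Subset.refl _, Finset.Subset.refl _, fun _ _ _ h _ => h⟩
  le_trans p q r h1 h2 := ⟨h2.1.trans h1.1, h2.2.1.trans h1.2.1, fun i hi l hl e =>
    h2.2.2 i hi l (h1.2.2 i (h2.2.1 hi) l hl e) e⟩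
  le_antisymm p q h1 h2 := CodingCondition.ext (h2.1.antisymm h1.1) (h2.2.1.antisymm h1.2.1)

instance : OrderTop (CodingCondition x X) where
  top := ⟨∅, ∅, by simp⟩
  le_top p := ⟨Finset.empty_subset _, Finset.empty_subset _,
    fun i hi => absurd hi (Finset.notMem_empty i)⟩

/-- Conditions with the same finite set of lists are compatible by uniting their promises, and there
are only countably many such sets. -/
theorem forcingCCC : ForcingCCC (CodingCondition x X) := by
  classical
  intro A hA
  refine (Set.mapsTo_univ lists A).countable_of_injOn (fun p hp q hq e => ?_) Set.countable_univ
  by_contra hne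
  refine hA p hp q hq hne ⟨⟨p.lists, p.indices ∪ q.indices, fun i hi => ?_⟩,
    ⟨Finset.Subset.refl _, Finset.subset_union_left, fun _ _ _ h _ => h⟩,
    ⟨e.symm.subset, Finset.subset_union_right, fun _ _ _ h _ => e ▸ h⟩⟩
  exact (Finset.mem_union.1 hi).elim (p.notMem i) (q.notMem i)

/-- The conditions which decide whether `i` belongs to the coded set, up to `n`. -/
def decide (x : I → ℕ → Bool) (X : Set I) (k : I × ℕ) : Set (CodingCondition x X) :=
  {p | k.1 ∈ p.indices ∨
    k.1 ∈ X ∧ ∃ l ∈ p.lists, k.2 ≤ l.length ∧ l = binaryPrefix (x k.1) l.length}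

theorem isCoinitial_decide (hx : Function.Injective x) (k : I × ℕ) :
    IsCoinitial (decide x X k) := by
  classical
  obtain ⟨i, n⟩ := k
  intro p
  by_cases hi : i ∈ X
  · have hne : ∀ j : p.indices, ∃ m, x j m ≠ x i m := fun j => by
      by_contra! h
      exact p.notMem j.1 j.2 (hx (funext h) ▸ hi)
    choose m hm using hne
    -- A prefix this long extends past a difference from every promised sequence, so adding it
    -- breaks no promise; the `+ 1` includes position `m j` itself.
    let N := n + (Finset.univ.sup m) + 1
    have hN : ∀ j : p.indices, m j < N := fun j => by
      have := Finset.le_sup (f := m) (Finset.mem_univ j)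
      omega
    refine ⟨⟨insert (binaryPrefix (x i) N) p.lists, p.indices, p.notMem⟩, Or.inr ⟨hi, _,
      Finset.mem_insert_self _ _, ?_, ?_⟩, Finset.subset_insert _ _, Finset.Subset.refl _,
      fun j hj l hl e => ?_⟩
    · rw [length_binaryPrefix]
      show n ≤ n + _ + 1
      omega
    · rw [length_binaryPrefix]
    · rcases Finset.mem_insert.1 hl with rfl | hl
      · rw [length_binaryPrefix] at e
        exact (binaryPrefix_ne (hm ⟨j, hj⟩) (hN ⟨j, hj⟩) e.symm).elim
      · exact hl
  · refine ⟨⟨p.lists, insert i p.indices, fun j hj => ?_⟩, Or.inl (Finset.mem_insert_self _ _),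
      Finset.Subset.refl _, Finset.subset_insert _ _, fun _ _ _ h _ => h⟩
    rcases Finset.mem_insert.1 hj with rfl | hj
    exacts [hi, p.notMem j hj]

end CodingCondition

/-- Under `MA_κ`, every set of indices of `κ` many binary sequences is coded by a set of lists. -/
theorem MartinAxiomAt.exists_coding_set {κ : Cardinal.{u}} (hMA : MartinAxiomAt κ) (hκ : ℵ₀ ≤ κ)
    {I : Type u} (hI : #I ≤ κ) {x : I → ℕ → Bool} (hx : Function.Injective x) (X : Set I) :
    ∃ d : Set (List Bool), ∀ i,
      i ∈ X ↔ ∀ n, ∃ l ∈ d, n ≤ l.length ∧ l = binaryPrefix (x i) l.length := by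
  have hcard : #(Set.range (CodingCondition.decide x X)) ≤ κ := by
    have h : #(Set.range (CodingCondition.decide x X)) ≤ #(I × ℕ) := Cardinal.mk_range_le
    refine h.trans ?_
    rw [Cardinal.mk_prod, Cardinal.mk_nat, Cardinal.lift_aleph0, Cardinal.lift_uzero]
    exact Cardinal.mul_le_of_le hκ hI hκ
  obtain ⟨G, hG⟩ := hMA (CodingCondition x X) CodingCondition.forcingCCC _ hcard
    (by rintro _ ⟨k, rfl⟩; exact CodingCondition.isCoinitial_decide hx k)
  refine ⟨{l | ∃ p ∈ G, l ∈ p.lists}, fun i => ⟨fun hi n => ?_, fun h => ?_⟩⟩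
  · obtain ⟨p, hpG, hp | ⟨-, l, hl, h⟩⟩ := hG _ ⟨(i, n), rfl⟩
    · exact (p.notMem i hp hi).elim
    · exact ⟨l, ⟨p, hpG, hl⟩, h⟩
  · by_contra hi
    obtain ⟨p, hpG, hp | ⟨h', -⟩⟩ := hG _ ⟨(i, 0), rfl⟩
    -- The promise in `p` forces every coded prefix of `x i` into `p.lists`, but this one is longer
    -- than all lists there.
    · obtain ⟨l, ⟨q, hqG, hl⟩, hn, hil⟩ := h (p.lists.sup List.length + 1)
      obtain ⟨r, -, hrp, hrq⟩ := G.directed _ hpG _ hqG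
      have := Finset.le_sup (f := List.length) (hrp.2.2 i hp l (hrq.1 hl) hil)
      omega
    · exact hi h'

/-- Each subset of a `κ`-sized family of reals is recovered from its coding set, and there are only
`𝔠` sets of binary lists. -/
theorem MartinAxiomAt.two_power_le {κ : Cardinal.{u}} (hMA : MartinAxiomAt κ) (hκ : ℵ₀ ≤ κ)
    (hκ' : κ ≤ 𝔠) : (2 : Cardinal.{u}) ^ κ ≤ 𝔠 := by
  obtain ⟨I, rfl⟩ := κ.exists_rep
  change #I ≤ 𝔠 at hκ'
  change (2 : Cardinal.{u}) ^ #I ≤ 𝔠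
  obtain ⟨x⟩ : Nonempty (I ↪ (ℕ → Bool)) := by
    rw [← Cardinal.lift_mk_le']
    simpa using hκ'
  choose d hd using fun X : Set I => hMA.exists_coding_set hκ le_rfl x.injective X
  have hinj : Function.Injective d := fun X Y e => by
    ext i
    rw [hd, hd, e]
  have := Cardinal.mk_le_of_injective (Equiv.ulift.{u}.symm.injective.comp hinj)
  simpa [Cardinal.mk_set] using this

/-- Under `MA_κ` for an infinite cardinal `κ ≤ 𝔠`, the cofinality of `𝔠` exceeds `κ`. -/
theorem MartinAxiomAt.lt_cof_continuum {κ : Cardinal.{u}} (hMA : MartinAxiomAt κ) (hκ : ℵ₀ ≤ κ)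
    (hκ' : κ ≤ 𝔠) : κ < (𝔠 : Cardinal.{u}).ord.cof := by
  have h : (2 : Cardinal.{u}) ^ κ = 𝔠 := le_antisymm (hMA.two_power_le hκ hκ') (by
    rw [← Cardinal.two_power_aleph0]
    exact Cardinal.power_le_power_left two_ne_zero hκ)
  rw [← h]
  exact Cardinal.lt_cof_ord_power hκ (by simp)

theorem MartinAxiom.not_isWideUngradableTree (hMA : MartinAxiom.{u})
    (hCH : ¬ ContinuumHypothesis.{u}) (T : Type u) [PartialOrder T] :
    ¬ IsWideUngradableTree 𝔠 T := by
  intro hT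
  have := hT.toIsWellStratifiedTree
  have h1 : (ℵ₁ : Cardinal.{u}) < 𝔠 := lt_of_le_of_ne Cardinal.aleph_one_le_continuum (Ne.symm hCH)
  have hT𝔠 : #T < 𝔠 := by
    rw [mk_eq_sum_levels hT.countable_branch]
    refine (Cardinal.sum_le_mk_mul_iSup _).trans_lt (Cardinal.mul_lt_of_lt
      Cardinal.aleph0_le_continuum (mk_omega_one_toType.trans_lt h1)
      (Cardinal.iSup_lt_of_lt_cof_ord ?_ fun i => hT.cc.mk_lt (isAntichain_treeLevel _)))
    rw [mk_omega_one_toType]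
    exact (hMA _ h1).lt_cof_continuum (Cardinal.aleph0_le_aleph 1) h1.le
  exact hT.ungradable ((hMA _ hT𝔠).gradable_real hT.countable_branch le_rfl)

/-! ### The padded tree -/

namespace Pad

variable {T : Type u} [PartialOrder T] [IsWellStratifiedTree T]

/-- The node of the original tree from which a node of the padded tree comes. -/
def base : Pad T → T
  | node x => x
  | below x _ => x

/-- A node of the padded tree is new if it was added below a node of the original tree. -/
def isNode : Pad T → Bool
  | node _ => true
  | below _ _ => false

theorem base_isNode_injective : Function.Injective fun a : Pad T => (a.base, a.isNode) := by
  rintro (x | ⟨x, hx⟩) (y | ⟨y, hy⟩) h <;> simp_all [base, isNode]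

/-- The padded order is lexicographic, with the new node preceding its base; well-foundedness is
inherited from `T ×ₗ Bool`. -/
theorem le_iff {a b : Pad T} :
    a ≤ b ↔ a.base < b.base ∨ a.base = b.base ∧ (a.isNode → b.isNode) := by
  change Pad.le a b ↔ _
  rcases a with x | ⟨x, hx⟩ <;> rcases b with y | ⟨y, hy⟩ <;>
    simp [Pad.le, base, isNode, le_iff_lt_or_eq]

theorem node_le_node {x y : T} : node x ≤ node y ↔ x ≤ y := Iff.rfl

theorem node_lt_node {x y : T} : node x < node y ↔ x < y := by
  rw [lt_iff_le_not_ge, lt_iff_le_not_ge, node_le_node, node_le_node]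

theorem below_lt_node {x : T} (hx) : below x hx < node x := by
  refine lt_of_le_of_ne (show x ≤ x from le_rfl) (by simp)

theorem base_monotone : Monotone (base : Pad T → T) := fun a b h => by
  rcases le_iff.1 h with h | h
  exacts [h.le, h.1.le]

theorem wellFoundedLT : WellFoundedLT (Pad T) := by
  have hwf : WellFounded (fun a b : T ×ₗ Bool => a < b) := wellFounded_lt
  refine ⟨Subrelation.wf (fun {a b} h => ?_)
    (InvImage.wf (fun a : Pad T => toLex (a.base, a.isNode)) hwf)⟩
  change toLex (a.base, a.isNode) < toLex (b.base, b.isNode)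
  rw [Prod.Lex.toLex_lt_toLex]
  refine (le_iff.1 h.le).imp_right fun h' => ⟨h'.1, ?_⟩
  refine lt_of_le_of_ne (Bool.le_iff_imp.2 h'.2) fun e => h.ne ?_
  exact base_isNode_injective (Prod.ext h'.1 e)

instance : IsWellStratifiedTree (Pad T) where
  isChain_Iic c a ha b hb _ := by
    change a ≤ b ∨ b ≤ a
    rw [le_iff, le_iff]
    rcases IsTreeOrder.le_or_le (base_monotone ha) (base_monotone hb) with h | h <;>
    rcases h.lt_or_eq with h | h
    · exact Or.inl (Or.inl h)
    · cases a.isNode <;> cases b.isNode <;> simp [h]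
    · exact Or.inr (Or.inl h)
    · cases a.isNode <;> cases b.isNode <;> simp [h]
  exists_root := by
    obtain ⟨r, hr⟩ := IsTreeOrder.exists_root (T := T)
    refine ⟨below r ?_, fun a => ?_⟩
    · rintro ⟨α, hα⟩
      obtain ⟨p, hp, -⟩ := exists_pred_of_nodeRank_eq_succ hα
      exact hp.not_ge (hr p)
    · cases a with
      | node x => exact hr x
      | below x hx => exact hr x
  isWF_Iic _ :=
    have := wellFoundedLT (T := T)
    Set.IsWF.of_wellFoundedLT _

theorem countable_of_isChain (hT : ∀ C : Set T, IsChain (· ≤ ·) C → C.Countable)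
    {B : Set (Pad T)} (hB : IsChain (· ≤ ·) B) : B.Countable := by
  have hC : (base '' B).Countable := hT _ (hB.image_of_map_rel _ _ _ fun _ _ h => base_monotone h)
  refine ((hC.prod (Set.countable_univ (α := Bool))).preimage base_isNode_injective).mono ?_
  exact fun a ha => ⟨⟨a, ha, rfl⟩, Set.mem_univ _⟩

/-- If the padded tree is `ℝ`-gradable, then the original tree is `ℚ`-gradable. -/
theorem gradable_rat (h : Gradable ℝ (Pad T)) : Gradable ℚ T := by
  obtain ⟨f, hf⟩ := h
  -- On successor levels `p` is the old immediate predecessor; on all others it is the added node.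
  have hp : ∀ x : T, ∃ p : Pad T, p < node x ∧ ∀ y < x, node y ≤ p := fun x => by
    by_cases hx : ∃ α : Ordinal.{u}, nodeRank x = Order.succ α
    · obtain ⟨α, hα⟩ := hx
      obtain ⟨p, hp, h⟩ := exists_pred_of_nodeRank_eq_succ hα
      exact ⟨node p, node_lt_node.2 hp, h⟩
    · exact ⟨below x hx, below_lt_node hx, fun y hy => hy⟩
  choose p hp1 hp2 using hp
  exact exists_strictMono_rat hf node p hp1 fun x y => hp2 y x

end Pad

/-! ### The tree of injective functions -/

namespace InOmega

/-- There is no countable colouring of `In_ω` giving comparable nodes different colours. -/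
theorem exists_lt_color_eq (c : InOmega → ℕ) : ∃ f g, f < g ∧ c f = c g := by
  classical
  by_contra! hc
  -- The recursion sets `F α` to the colour of the restriction of `F` to `α`. Restrictions are
  -- comparable nodes, so their colours differ and `F` stays injective; the default `0` is never
  -- reached.
  let step : (α : Ordinal.{0}) → ((β : Ordinal.{0}) → β < α → ℕ) → ℕ := fun α F =>
    if h : Function.Injective fun x : Set.Iio α => F x.1 x.2 then c ⟨α, _, h⟩ else 0
  let F : Ordinal.{0} → ℕ := WellFounded.fix wellFounded_lt step
  have hF : ∀ α, F α = step α fun β _ => F β := fun α => WellFounded.fix_eq _ _ α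
  have hinj : ∀ α, Function.Injective fun x : Set.Iio α => F x.1 := by
    intro α
    induction α using WellFoundedLT.induction with
    | ind α ih =>
      have hFc : ∀ β (h : β < α), F β = c ⟨β, _, ih β h⟩ := fun β h => by
        rw [hF]
        exact dif_pos (ih β h)
      have hne : ∀ β γ (hβ : β < α) (hγ : γ < α), β < γ → F β ≠ F γ := fun β γ hβ hγ h => by
        rw [hFc β hβ, hFc γ hγ]
        refine hc _ _ (lt_of_le_of_ne ?_ fun e => h.ne (congrArg dom e))
        exact ⟨h.le, fun _ => rfl⟩
      rintro ⟨β, hβ⟩ ⟨γ, hγ⟩ e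
      rcases lt_trichotomy β γ with h | h | h
      · exact (hne β γ hβ hγ h e).elim
      · exact Subtype.ext h
      · exact (hne γ β hγ hβ h e.symm).elim
  refine not_injective_of_ordinal F fun β γ e => ?_
  have := @hinj (Order.succ (max β γ)) ⟨β, Order.lt_succ_iff.2 (le_max_left β γ)⟩
    ⟨γ, Order.lt_succ_iff.2 (le_max_right β γ)⟩ e
  exact congrArg Subtype.val this

theorem not_gradable_rat : ¬ Gradable ℚ InOmega := by
  rintro ⟨q, hq⟩
  obtain ⟨f, g, hfg, e⟩ := exists_lt_color_eq fun f => Encodable.encode (q f)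
  exact (hq hfg).ne (Encodable.encode_injective e)

theorem toFun_eq_of_le {f g : InOmega} (h : f ≤ g) {α : Ordinal.{0}} (hf : α < f.dom)
    (hg : α < g.dom) : f.toFun ⟨α, hf⟩ = g.toFun ⟨α, hg⟩ :=
  h.2 ⟨α, hf⟩

/-- Assign to each nonmaximal `f` in the chain the value at `f.dom` of some larger member. Members
agree where both are defined and are injective, so these naturals are distinct. At most one element
is maximal. -/
theorem countable_of_isChain {C : Set InOmega} (hC : IsChain (· ≤ ·) C) : C.Countable := by
  classical
  let C' : Set InOmega := {f | f ∈ C ∧ ∃ g ∈ C, f < g}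
  have hsub : (C \ C').Subsingleton := by
    rintro f ⟨hf, hf'⟩ g ⟨hg, hg'⟩
    by_contra hne
    rcases hC.total hf hg with h | h
    · exact hf' ⟨hf, g, hg, lt_of_le_of_ne h hne⟩
    · exact hg' ⟨hg, f, hf, lt_of_le_of_ne h (Ne.symm hne)⟩
  have hC' : C'.Countable := by
    choose s hsC hs using fun f : C' => f.2.2
    have hlt : ∀ f g : C', f.1 < g.1 →
        (s f).toFun ⟨f.1.dom, dom_lt_of_lt (hs f)⟩ ≠ (s g).toFun ⟨g.1.dom, dom_lt_of_lt (hs g)⟩ := by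
      intro f g hfg
      have hd := dom_lt_of_lt hfg
      have hd' : f.1.dom < (s g).dom := hd.trans (dom_lt_of_lt (hs g))
      have e : (s f).toFun ⟨f.1.dom, dom_lt_of_lt (hs f)⟩ = (s g).toFun ⟨f.1.dom, hd'⟩ := by
        rcases hC.total (hsC f) (hsC g) with h | h
        · exact toFun_eq_of_le h _ _
        · exact (toFun_eq_of_le h _ _).symm
      rw [e]
      exact fun e' => hd.ne (congrArg Subtype.val ((s g).inj e'))
    have hinj : Function.Injective fun f : C' => (s f).toFun ⟨f.1.dom, dom_lt_of_lt (hs f)⟩ := by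
      intro f g e
      by_contra hne
      have hne' : f.1 ≠ g.1 := fun e => hne (Subtype.ext e)
      rcases hC.total f.2.1 g.2.1 with h | h
      · exact hlt f g (lt_of_le_of_ne h hne') e
      · exact hlt g f (lt_of_le_of_ne h hne'.symm) e.symm
    exact hinj.countable
  refine (hC'.union hsub.countable).mono fun f hf => ?_
  by_cases h : f ∈ C'
  exacts [Or.inl h, Or.inr ⟨hf, h⟩]

/-- The well-order of the range of an injective function given by its domain. -/
def code (f : InOmega) : Set (ℕ × ℕ) :=
  {k | ∃ a b : Set.Iio f.dom, a.1 ≤ b.1 ∧ k = (f.toFun a, f.toFun b)}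

theorem le_of_code_eq {f g : InOmega} (h : f.code = g.code) : f ≤ g := by
  have key : ∀ α (hf : α < f.dom), ∃ hg : α < g.dom, f.toFun ⟨α, hf⟩ = g.toFun ⟨α, hg⟩ := by
    intro α
    induction α using WellFoundedLT.induction with
    | ind α ih =>
      intro hf
      -- The diagonal of the code recovers the range, so `f` at `α` is `g` at some `γ`. If `γ < α`,
      -- induction contradicts injectivity of `f`; if `γ > α`, the value of `g` at `α` would be a
      -- value of `f` at or before `α`, contradicting injectivity of `g`.
      obtain ⟨γ, _, -, e⟩ : (f.toFun ⟨α, hf⟩, f.toFun ⟨α, hf⟩) ∈ g.code :=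
        h ▸ ⟨_, _, le_rfl, rfl⟩
      replace e := (Prod.mk.inj e).1
      rcases lt_trichotomy γ.1 α with hlt | heq | hlt
      · obtain ⟨hg, e'⟩ := ih γ.1 hlt (hlt.trans hf)
        have := congrArg Subtype.val (f.inj (e'.trans e.symm))
        exact (hlt.ne this).elim
      · subst heq
        exact ⟨γ.2, e⟩
      · have hα : α < g.dom := hlt.trans γ.2
        obtain ⟨a, b, hab, e'⟩ : (g.toFun ⟨α, hα⟩, g.toFun γ) ∈ f.code :=
          h ▸ ⟨_, _, hlt.le, rfl⟩
        obtain ⟨e1, e2⟩ := Prod.mk.inj e'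
        have hb : b = ⟨α, hf⟩ := f.inj (e2.symm.trans e.symm)
        subst hb
        rcases hab.lt_or_eq with hlt' | heq
        · obtain ⟨hg, e3⟩ := ih a.1 hlt' a.2
          have := congrArg Subtype.val (g.inj (e1.trans e3))
          exact (hlt'.ne this.symm).elim
        · have ha : a = ⟨α, hf⟩ := Subtype.ext heq
          rw [ha, e] at e1
          have := congrArg Subtype.val (g.inj e1)
          exact (hlt.ne this).elim
  refine ⟨le_of_not_gt fun hlt => ?_, fun x => (key x.1 x.2).2⟩
  obtain ⟨hg, -⟩ := key g.dom hlt
  exact hg.false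

theorem code_injective : Function.Injective code := fun _ _ h =>
  le_antisymm (le_of_code_eq h) (le_of_code_eq h.symm)

end InOmega

/-- An injective coding of the nodes of `Pad(In_ω)` by sets of natural numbers and bits. -/
theorem injective_code_padInOmega :
    Function.Injective fun a : Pad InOmega => (a.base.code, a.isNode) := fun a b h => by
  obtain ⟨h1, h2⟩ := Prod.mk.inj h
  exact Pad.base_isNode_injective (Prod.ext (InOmega.code_injective h1) h2)

/-- Working up to isomorphism covers both `Pad InOmega`, which lives in `Type 1`, and its copies in
other universes. The chain condition holds because the whole tree has size at most `𝔠`. -/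
theorem isWideUngradableTree_of_orderIso {T : Type u} [PartialOrder T] (e : T ≃o Pad InOmega) :
    IsWideUngradableTree (Order.succ 𝔠) T where
  isChain_Iic x a ha b hb _ :=
    (IsTreeOrder.le_or_le (e.monotone ha) (e.monotone hb)).imp e.le_iff_le.1 e.le_iff_le.1
  exists_root := by
    obtain ⟨r, hr⟩ := IsTreeOrder.exists_root (T := Pad InOmega)
    exact ⟨e.symm r, fun x => e.symm_apply_le.2 (hr _)⟩
  isWF_Iic x :=
    have : WellFoundedLT T := e.strictMono.wellFoundedLT
    Set.IsWF.of_wellFoundedLT _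
  ungradable := fun ⟨f, hf⟩ =>
    InOmega.not_gradable_rat (Pad.gradable_rat ⟨_, hf.comp e.symm.strictMono⟩)
  cc := by
    rintro ⟨A, -, hA⟩
    have h1 : Cardinal.lift.{0} #T ≤ Cardinal.lift.{u} #(Set (ℕ × ℕ) × Bool) :=
      Cardinal.lift_mk_le_lift_mk_of_injective (injective_code_padInOmega.comp e.injective)
    have h2 : #T ≤ 𝔠 := by simpa using h1
    exact (Order.lt_succ 𝔠).not_ge (hA ▸ (Cardinal.mk_set_le A).trans h2)
  countable_branch B hB := by
    have h := Pad.countable_of_isChain (fun _ => InOmega.countable_of_isChain)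
      (hB.isChain.image_of_map_rel _ _ _ fun _ _ h => e.monotone h)
    exact Set.countable_of_injective_of_countable_image e.injective.injOn h

theorem small_padInOmega : Small.{u} (Pad InOmega) :=
  small_of_injective injective_code_padInOmega

theorem proposition6p10 :
    -- (1) the Suslin trees are exactly the `<ℵ₁`-wide `ℝ`-ungradable trees
    (∀ (T : Type u) [PartialOrder T], IsSuslinTree T ↔ IsWideUngradableTree ℵ₁ T) ∧
    -- (2) `MA_κ` rules out `<κ⁺`-wide `ℝ`-ungradable trees
    (∀ κ : Cardinal.{u}, ℵ₁ ≤ κ → MartinAxiomAt κ →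
      ∀ (T : Type u) [PartialOrder T], ¬ IsWideUngradableTree (Order.succ κ) T) ∧
    -- (3) `MA + ¬CH` rules out `<𝔠`-wide `ℝ`-ungradable trees
    (MartinAxiom.{u} → ¬ ContinuumHypothesis.{u} →
      ∀ (T : Type u) [PartialOrder T], ¬ IsWideUngradableTree 𝔠 T) ∧
    -- (4) `Pad(In_ω)` is a `<𝔠⁺`-wide `ℝ`-ungradable tree, and every universe contains such a tree
    IsWideUngradableTree (Order.succ 𝔠) (Pad InOmega) ∧
    (∃ (T : Type u) (_ : PartialOrder T), IsWideUngradableTree (Order.succ 𝔠) T) := by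
  refine ⟨fun T _ => isSuslinTree_iff, fun κ hκ hMA T _ => hMA.not_isWideUngradableTree hκ T,
    fun hMA hCH T _ => hMA.not_isWideUngradableTree hCH T,
    isWideUngradableTree_of_orderIso (OrderIso.refl _), ?_⟩
  have := small_padInOmega.{u}
  let e := (equivShrink.{u} (Pad InOmega)).symm
  let inst : PartialOrder (Shrink.{u} (Pad InOmega)) := PartialOrder.lift e e.injective
  exact ⟨_, inst, isWideUngradableTree_of_orderIso ⟨e, Iff.rfl⟩⟩
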